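/- Let $\mathcal U=\{z\in\mathbb C:|z|<1\}$. Let $f$ be analytic in $\mathcal U$ with $f(0)=0$ and $f'(0)=1$, and let $g$ be analytic in $\mathcal U$ with $g(0)=1$. Let $\alpha,\beta,A$ be complex numbers with $\operatorname{Re}\alpha>\tfrac12$ and $0<|A|\le 1$, and suppose that $g(z)\ne\beta$ for all $z\in\mathcal U$. Assume that $$\left|\frac1\alpha\left(\frac{f'(z)}{g(z)-\beta}-1\right)\right|<|A|$$ for all $z\in\mathcal U$, and that $$\left|\left(\frac{f'(z)}{g(z)-\beta}-1\right)|z|^2+(1-|z|^2)\left[\frac{1-\alpha}{\alpha}\,\frac{zf'(z)}{f(z)}+\frac{zg'(z)}{g(z)-\beta}\right]\right|\le|A|$$ for all $z\in\mathcal U$ at which the left-hand side is defined, that is, with $f(z)\neq0$. Then $f$ is univalent (analytic and injective) in $\mathcal U$. -/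

import Mathlib

/-- The open unit disk of the complex plane. -/
def unitDisk : Set ℂ := Metric.ball 0 1

/-- The class of analytic functions in the open unit disk,
normalized by `f 0 = 0` and `f' 0 = 1`. -/
structure IsNormalizedAnalytic (f : ℂ → ℂ) : Prop where
  analytic : AnalyticOnNhd ℂ f unitDisk
  map_zero : f 0 = 0
  deriv_zero : deriv f 0 = 1

/-- Univalence on a set: analytic and injective there. -/
def IsUnivalentOn (f : ℂ → ℂ) (s : Set ℂ) : Prop :=
  AnalyticOnNhd ℂ f s ∧ Set.InjOn f s

/-! The proof is a Loewner-type argument by characteristics. Write `f u = u * φ u`, `k = (g - β) /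
α` and `F(u, s) = f u * (1 + s * k u / φ u) ^ α`. Then `F` is constant along solutions of `u' = -u /
Q` with `Q = q₀ + s * q₁`, where `q₀ = f' / (g - β)` and `q₁ = 1 + ((1 - α) / α) * u f' / f + u g' /
(g - β)`.

On the circle `|u|² = 1 / (1 + s)` the second bound of the theorem gives `|Q / (1 + s) - 1| ≤ 1`.
The maximum principle carries this to the disc, where it means `Re (1 / Q) ≥ 1 / (2 * (1 + s))`:
characteristics shrink at least as fast as the radius of the disc, so they exist for all time
(`exists_isCharacteristic`).

If `f z = f w`, follow the characteristics from `z` and `w` to a large time `T`. There `F` still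
takes equal values (`chain_eq`), and both points are so close to `0` that `F(·, T)` is injective
(`exists_uniform_injective`). Hence the characteristics meet, and backward uniqueness
(`IsCharacteristic.unique`) gives `z = w`. -/

open Set Metric Filter Topology
open scoped NNReal

/-! ### Flows of inward-pointing fields in a ball. -/

/-- The radial retraction onto the closed ball of radius `ρ` about the origin. -/
noncomputable def radialRetraction {E : Type*} [NormedAddCommGroup E] [NormedSpace ℝ E]
    (ρ : ℝ) (x : E) : E :=
  (ρ / max ρ ‖x‖) • x

section Retraction

variable {E : Type*} [NormedAddCommGroup E] [NormedSpace ℝ E] {ρ : ℝ}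

theorem radialRetraction_mem (hρ : 0 < ρ) (x : E) :
    radialRetraction ρ x ∈ closedBall (0 : E) ρ := by
  have hm : 0 < max ρ ‖x‖ := lt_max_of_lt_left hρ
  rw [mem_closedBall_zero_iff, radialRetraction, norm_smul, Real.norm_of_nonneg (by positivity),
    div_mul_eq_mul_div, div_le_iff₀ hm]
  exact mul_le_mul_of_nonneg_left (le_max_right _ _) hρ.le

theorem radialRetraction_of_mem (hρ : 0 < ρ) {x : E} (hx : x ∈ closedBall (0 : E) ρ) :
    radialRetraction ρ x = x := by
  rw [mem_closedBall_zero_iff] at hx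
  rw [radialRetraction, max_eq_left hx, div_self hρ.ne', one_smul]

/-- The difference splits into a change of vector with fixed factor and a change of factor with
fixed vector; each contributes at most `‖x - y‖`, whence the constant 2. -/
theorem lipschitzWith_radialRetraction (hρ : 0 < ρ) :
    LipschitzWith 2 (radialRetraction ρ : E → E) := by
  refine LipschitzWith.of_dist_le_mul fun x y => ?_
  have hmx : 0 < max ρ ‖x‖ := lt_max_of_lt_left hρ
  have hmy : 0 < max ρ ‖y‖ := lt_max_of_lt_left hρ
  have hsub : radialRetraction ρ x - radialRetraction ρ y =
      (ρ / max ρ ‖x‖) • (x - y) + (ρ / max ρ ‖x‖ - ρ / max ρ ‖y‖) • y := by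
    simp only [radialRetraction]; module
  have h1 : ρ / max ρ ‖x‖ ≤ 1 := (div_le_one hmx).2 (le_max_left _ _)
  have h2 : |max ρ ‖y‖ - max ρ ‖x‖| ≤ ‖x - y‖ := by
    have := abs_max_sub_max_le_abs ‖y‖ ‖x‖ ρ
    rw [max_comm ρ, max_comm ρ]
    exact this.trans ((abs_norm_sub_norm_le y x).trans (norm_sub_rev y x).le)
  have h3 : |ρ / max ρ ‖x‖ - ρ / max ρ ‖y‖| * ‖y‖ ≤ ‖x - y‖ := by
    have : ρ / max ρ ‖x‖ - ρ / max ρ ‖y‖ =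
        (ρ / max ρ ‖x‖) * ((max ρ ‖y‖ - max ρ ‖x‖) / max ρ ‖y‖) := by
      field_simp
    rw [this, abs_mul, abs_of_pos (by positivity : 0 < ρ / max ρ ‖x‖), abs_div, abs_of_pos hmy]
    calc ρ / max ρ ‖x‖ * (|max ρ ‖y‖ - max ρ ‖x‖| / max ρ ‖y‖) * ‖y‖
        = (ρ / max ρ ‖x‖) * |max ρ ‖y‖ - max ρ ‖x‖| * (‖y‖ / max ρ ‖y‖) := by ring
      _ ≤ 1 * ‖x - y‖ * 1 := by
        gcongr
        exact (div_le_one hmy).2 (le_max_right _ _)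
      _ = ‖x - y‖ := by ring
  rw [dist_eq_norm, dist_eq_norm, hsub]
  refine (norm_add_le _ _).trans ?_
  rw [norm_smul, norm_smul, Real.norm_eq_abs, Real.norm_eq_abs,
    abs_of_pos (by positivity : 0 < ρ / max ρ ‖x‖)]
  have h4 : ρ / max ρ ‖x‖ * ‖x - y‖ ≤ 1 * ‖x - y‖ := by gcongr
  simp only [NNReal.coe_ofNat]
  linarith

end Retraction

/-- A time-dependent vector field on a closed ball that is uniformly Lipschitz and does not point
outwards has an integral curve in the ball on any time interval on which the field is defined. -/
theorem exists_integralCurve_closedBall {E : Type*} [NormedAddCommGroup E] [InnerProductSpace ℝ E]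
    [CompleteSpace E] {v : ℝ → E → E} {a b ρ : ℝ} {K : ℝ≥0} (hab : a ≤ b) (hρ : 0 < ρ)
    (hlip : ∀ t ∈ Icc a b, LipschitzOnWith K (v t) (closedBall 0 ρ))
    (hcont : ∀ x ∈ closedBall (0 : E) ρ, ContinuousOn (v · x) (Icc a b))
    (hin : ∀ t ∈ Icc a b, ∀ x ∈ closedBall (0 : E) ρ, inner ℝ x (v t x) ≤ 0)
    {x₀ : E} (hx₀ : x₀ ∈ closedBall (0 : E) ρ) :
    ∃ w : ℝ → E, w a = x₀ ∧ ∀ t ∈ Icc a b, w t ∈ closedBall (0 : E) ρ ∧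
      HasDerivWithinAt w (v t (w t)) (Icc a b) t := by
  have h0 : (0 : E) ∈ closedBall (0 : E) ρ := mem_closedBall_self hρ.le
  obtain ⟨M, hM⟩ := isCompact_Icc.exists_bound_of_continuousOn (hcont 0 h0)
  have hM0 : 0 ≤ M := (norm_nonneg _).trans (hM a ⟨le_rfl, hab⟩)
  have hbound : ∀ t ∈ Icc a b, ∀ x : E, ‖v t (radialRetraction ρ x)‖ ≤ M + K * ρ := by
    intro t ht x
    have hx := radialRetraction_mem hρ x
    have h1 := (hlip t ht).dist_le_mul _ hx _ h0
    rw [dist_eq_norm, dist_zero_right] at h1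
    have h2 := norm_le_norm_add_norm_sub' (v t (radialRetraction ρ x)) (v t 0)
    have h3 : (K : ℝ) * ‖radialRetraction ρ x‖ ≤ K * ρ := by
      gcongr; exact mem_closedBall_zero_iff.1 hx
    linarith [hM t ht]
  have hL : 0 ≤ M + K * ρ := by positivity
  let L : ℝ≥0 := ⟨M + K * ρ, hL⟩
  -- The retracted field is bounded on the whole space, so the Picard–Lindelöf radius can be speed
  -- times duration and the solution covers all of `[a, b]`.
  let A : ℝ≥0 := ⟨(M + K * ρ) * (b - a), mul_nonneg hL (sub_nonneg.2 hab)⟩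
  have hP : IsPicardLindelof (fun t x => v t (radialRetraction ρ x))
      (⟨a, le_rfl, hab⟩ : Icc a b) x₀ A 0 L (K * 2) := by
    refine ⟨fun t ht => ?_, fun x _ => hcont _ (radialRetraction_mem hρ x),
      fun t ht x _ => hbound t ht x, ?_⟩
    · exact (hlip t ht).comp (lipschitzWith_radialRetraction hρ).lipschitzOnWith
        fun x _ => radialRetraction_mem hρ x
    · simp only [NNReal.coe_zero, sub_zero, sub_self, max_eq_left (sub_nonneg.2 hab)]
      exact le_rfl
  obtain ⟨w, hwa, hw⟩ := hP.exists_eq_forall_mem_Icc_hasDerivWithinAt₀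
  simp only at hwa
  -- The retraction of `w t` is a positive multiple of `w t`, so the sign condition on the ball also
  -- controls `‖w‖` outside it. The solution therefore never leaves the ball, where retracted and
  -- original fields agree.
  have hanti : AntitoneOn (fun t => ‖w t‖ ^ 2) (Icc a b) := by
    have hd : ∀ t ∈ Icc a b, HasDerivWithinAt (fun t => ‖w t‖ ^ 2)
        (2 * inner ℝ (w t) (v t (radialRetraction ρ (w t)))) (Icc a b) t :=
      fun t ht => (hw t ht).norm_sq
    refine antitoneOn_of_deriv_nonpos (convex_Icc a b) (fun t ht => (hd t ht).continuousWithinAt)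
      (fun t ht => ?_) fun t ht => ?_
    · exact ((hd t (interior_subset ht)).mono interior_subset).differentiableWithinAt
    · have hmem := interior_subset ht
      rw [((hd t hmem).hasDerivAt (mem_interior_iff_mem_nhds.1 ht)).deriv]
      have hm : 0 < max ρ ‖w t‖ := lt_max_of_lt_left hρ
      have hc : 0 < ρ / max ρ ‖w t‖ := by positivity
      have h1 := hin t hmem _ (radialRetraction_mem hρ (w t))
      rw [radialRetraction, real_inner_smul_left] at h1
      have h2 := nonpos_of_mul_nonpos_right h1 hc
      rw [radialRetraction]
      linarith
  have hmem : ∀ t ∈ Icc a b, w t ∈ closedBall (0 : E) ρ := by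
    intro t ht
    have h1 : ‖w t‖ ^ 2 ≤ ‖w a‖ ^ 2 := hanti ⟨le_rfl, hab⟩ ht ht.1
    rw [mem_closedBall_zero_iff] at hx₀ ⊢
    rw [hwa] at h1
    exact (pow_le_pow_iff_left₀ (norm_nonneg _) (norm_nonneg _) two_ne_zero).1 h1 |>.trans hx₀
  refine ⟨w, hwa, fun t ht => ⟨hmem t ht, ?_⟩⟩
  have := hw t ht
  rwa [radialRetraction_of_mem hρ (hmem t ht)] at this

/-- A family of holomorphic functions that is jointly continuous with a compact parameter interval
is uniformly Lipschitz on smaller discs. -/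
theorem exists_lipschitzOnWith_of_holomorphic {v : ℝ → ℂ → ℂ} {a b ρ R : ℝ} (hρR : ρ < R)
    (hcont : ContinuousOn (fun p : ℝ × ℂ => v p.1 p.2) (Icc a b ×ˢ ball 0 R))
    (hdiff : ∀ t ∈ Icc a b, DifferentiableOn ℂ (v t) (ball 0 R)) :
    ∃ K : ℝ≥0, ∀ t ∈ Icc a b, LipschitzOnWith K (v t) (closedBall 0 ρ) := by
  obtain ⟨r, hρr, hrR⟩ := exists_between hρR
  obtain ⟨M, hM⟩ := (isCompact_Icc.prod (isCompact_closedBall (0 : ℂ) r)).exists_bound_of_continuousOn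
    (hcont.mono (prod_mono_right (closedBall_subset_ball hrR)))
  have hd : 0 < r - ρ := sub_pos.2 hρr
  refine ⟨(M / (r - ρ)).toNNReal, fun t ht => ?_⟩
  refine (convex_closedBall (0 : ℂ) ρ).lipschitzOnWith_of_nnnorm_deriv_le (𝕜 := ℂ) (fun x hx => ?_)
    fun x hx => ?_
  · exact (hdiff t ht).differentiableAt
      (isOpen_ball.mem_nhds (closedBall_subset_ball hρR hx))
  -- Cauchy's estimate on discs of radius `r - ρ` turns the uniform bound `M` into a derivative
  -- bound.
  · have hsub : closedBall x (r - ρ) ⊆ closedBall (0 : ℂ) r := by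
      refine closedBall_subset_closedBall' ?_
      have := mem_closedBall.1 hx
      linarith
    have h := Complex.norm_deriv_le_of_forall_mem_sphere_norm_le (f := v t) (c := x) (C := M) hd
      (((hdiff t ht).mono (hsub.trans (closedBall_subset_ball hrR))).diffContOnCl_ball le_rfl)
      fun z hz => hM (t, z) ⟨ht, hsub (sphere_subset_closedBall hz)⟩
    rw [← NNReal.coe_le_coe, coe_nnnorm]
    exact h.trans (Real.le_coe_toNNReal _)

/-! ### Characteristics in shrinking discs. -/

/-- The radius of the disc on which the member at time `s` of the chain is considered. -/
noncomputable def chainRadius (s : ℝ) : ℝ := (√(1 + s))⁻¹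

/-- Coefficients `q₀`, `q₁` of a characteristic equation `u' = -u / (q₀ u + s * q₁ u)`
whose denominator is controlled on the circles `‖u‖ = chainRadius s`. -/
structure IsCharacteristicPair (q₀ q₁ : ℂ → ℂ) : Prop where
  diff_zero : DifferentiableOn ℂ q₀ (ball 0 1)
  diff_one : DifferentiableOn ℂ q₁ (ball 0 1)
  norm_le : ∀ u ∈ ball (0 : ℂ) 1,
    ‖q₀ u * ((‖u‖ ^ 2 : ℝ) : ℂ) + ((1 - ‖u‖ ^ 2 : ℝ) : ℂ) * q₁ u - 1‖ ≤ 1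
  zero_ne_zero : q₀ 0 ≠ 0
  one_re_pos : 0 < (q₁ 0).re

theorem chainRadius_pos {s : ℝ} (hs : 0 ≤ s) : 0 < chainRadius s := by
  unfold chainRadius; positivity

theorem chainRadius_le_one {s : ℝ} (hs : 0 ≤ s) : chainRadius s ≤ 1 :=
  inv_le_one_of_one_le₀ (Real.one_le_sqrt.2 (by linarith))

theorem chainRadius_lt_one {s : ℝ} (hs : 0 < s) : chainRadius s < 1 :=
  inv_lt_one_of_one_lt₀ (Real.lt_sqrt_of_sq_lt (by linarith))

theorem chainRadius_sq {s : ℝ} (hs : 0 ≤ s) : chainRadius s ^ 2 = (1 + s)⁻¹ := by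
  rw [chainRadius, inv_pow, Real.sq_sqrt (by linarith)]

theorem chainRadius_zero : chainRadius 0 = 1 := by simp [chainRadius]

theorem chainRadius_anti {s t : ℝ} (hs : 0 ≤ s) (hst : s ≤ t) : chainRadius t ≤ chainRadius s := by
  unfold chainRadius
  have : 0 < √(1 + s) := by positivity
  gcongr

theorem tendsto_chainRadius : Tendsto chainRadius atTop (𝓝 0) :=
  tendsto_inv_atTop_zero.comp
    (Real.tendsto_sqrt_atTop.comp (tendsto_atTop_add_const_left _ _ tendsto_id))

theorem hasDerivAt_chainRadius {s : ℝ} (hs : 0 ≤ s) :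
    HasDerivAt chainRadius (-(chainRadius s / (2 * (1 + s)))) s := by
  have h1 : 0 < 1 + s := by linarith
  have h2 : 0 < √(1 + s) := by positivity
  have h := (((hasDerivAt_id s).const_add 1).sqrt h1.ne').inv h2.ne'
  refine h.congr_deriv ?_
  simp only [chainRadius, id]
  rw [Real.sq_sqrt h1.le]
  field_simp

theorem continuousOn_chainRadius : ContinuousOn chainRadius (Ici 0) :=
  fun _ hs => (hasDerivAt_chainRadius hs).continuousAt.continuousWithinAt

namespace IsCharacteristicPair

variable {q₀ q₁ : ℂ → ℂ}

theorem mem_unit_ball {s : ℝ} (hs : 0 ≤ s) {u : ℂ} (hu : u ∈ ball (0 : ℂ) (chainRadius s)) :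
    u ∈ ball (0 : ℂ) 1 :=
  ball_subset_ball (chainRadius_le_one hs) hu

/-- On the boundary circle `‖u‖² = 1 / (1 + s)`, so the quotient equals `q₀ ‖u‖² + (1 - ‖u‖²) q₁`
and `norm_le` applies; the maximum principle does the rest. -/
theorem norm_sub_one_le_of_pos (h : IsCharacteristicPair q₀ q₁) {s : ℝ} (hs : 0 < s) {u : ℂ}
    (hu : u ∈ ball (0 : ℂ) (chainRadius s)) :
    ‖(q₀ u + s * q₁ u) / ((1 + s : ℝ) : ℂ) - 1‖ ≤ 1 := by
  have hR := chainRadius_pos hs.le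
  have hR1 := chainRadius_lt_one hs
  have hd : DifferentiableOn ℂ (fun u => (q₀ u + s * q₁ u) / ((1 + s : ℝ) : ℂ) - 1)
      (closedBall 0 (chainRadius s)) :=
    (((h.diff_zero.add (h.diff_one.const_mul _)).div_const _).sub_const _).mono
      (closedBall_subset_ball hR1)
  refine Complex.norm_le_of_forall_mem_frontier_norm_le isBounded_ball (hd.diffContOnCl_ball le_rfl)
    (fun z hz => ?_) (subset_closure hu)
  rw [frontier_ball _ hR.ne', mem_sphere_zero_iff_norm] at hz
  have h1 := h.norm_le z (by rw [mem_ball_zero_iff, hz]; exact hR1)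
  rw [hz, chainRadius_sq hs.le] at h1
  refine (congrArg norm ?_).trans_le h1
  have : (1 + s : ℂ) ≠ 0 := by exact_mod_cast (by linarith : (1 + s : ℝ) ≠ 0)
  push_cast
  field_simp
  ring

theorem norm_sub_one_le (h : IsCharacteristicPair q₀ q₁) {s : ℝ} (hs : 0 ≤ s) {u : ℂ}
    (hu : u ∈ ball (0 : ℂ) (chainRadius s)) :
    ‖(q₀ u + s * q₁ u) / ((1 + s : ℝ) : ℂ) - 1‖ ≤ 1 := by
  rcases hs.eq_or_lt with rfl | hs'
  -- At `s = 0` the boundary is the unit circle, outside the domain of the coefficients, so the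
  -- bound is obtained as a limit `s → 0+` at fixed `u`.
  · have hc : ContinuousAt (fun s : ℝ => ‖(q₀ u + s * q₁ u) / ((1 + s : ℝ) : ℂ) - 1‖) 0 := by
      have : ((1 + 0 : ℝ) : ℂ) ≠ 0 := by simp
      fun_prop (disch := assumption)
    refine le_of_tendsto (hc.tendsto.mono_left (nhdsWithin_le_nhds (s := Ioi 0))) ?_
    have hr : ∀ᶠ s in 𝓝[>] (0 : ℝ), ‖u‖ < chainRadius s :=
      (((hasDerivAt_chainRadius le_rfl).continuousAt.tendsto.eventually
        (lt_mem_nhds (mem_ball_zero_iff.1 hu))).filter_mono nhdsWithin_le_nhds)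
    filter_upwards [hr, self_mem_nhdsWithin] with s hs hs0
    exact h.norm_sub_one_le_of_pos hs0 (mem_ball_zero_iff.2 hs)
  · exact h.norm_sub_one_le_of_pos hs' hu

/-- A nonzero point of the closed unit disc about `1` has positive real part, and adding `s * q₁ 0`
keeps it positive. -/
theorem ne_zero (h : IsCharacteristicPair q₀ q₁) {s : ℝ} (hs : 0 ≤ s) : q₀ 0 + s * q₁ 0 ≠ 0 := by
  have h1 := h.norm_sub_one_le le_rfl (mem_ball_self (chainRadius_pos le_rfl))
  simp only [Complex.ofReal_zero, zero_mul, add_zero, Complex.ofReal_one, div_one] at h1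
  have h2 : Complex.normSq (q₀ 0 - 1) ≤ 1 := by
    rw [Complex.normSq_eq_norm_sq]; exact pow_le_one₀ (norm_nonneg _) h1
  have h3 := Complex.normSq_pos.2 h.zero_ne_zero
  rw [Complex.normSq_apply] at h2 h3
  simp only [Complex.sub_re, Complex.sub_im, Complex.one_re, Complex.one_im] at h2
  have h4 : 0 < (q₀ 0).re := by nlinarith
  intro h5
  have h6 := congrArg Complex.re h5
  rw [Complex.add_re, Complex.re_ofReal_mul, Complex.zero_re] at h6
  nlinarith [mul_nonneg hs h.one_re_pos.le]

/-- At a zero the modulus in `norm_sub_one_le` attains its maximal value 1. The strong maximum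
principle then makes the function constant, contradicting `ne_zero` at the origin. -/
theorem denom_ne_zero (h : IsCharacteristicPair q₀ q₁) {s : ℝ} (hs : 0 ≤ s) {u : ℂ}
    (hu : u ∈ ball (0 : ℂ) (chainRadius s)) : q₀ u + s * q₁ u ≠ 0 := by
  intro h0
  have hd : DifferentiableOn ℂ (fun u => (q₀ u + s * q₁ u) / ((1 + s : ℝ) : ℂ) - 1)
      (ball 0 (chainRadius s)) :=
    (((h.diff_zero.add (h.diff_one.const_mul _)).div_const _).sub_const _).mono
      (ball_subset_ball (chainRadius_le_one hs))
  have hmax : IsMaxOn (norm ∘ fun u => (q₀ u + s * q₁ u) / ((1 + s : ℝ) : ℂ) - 1)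
      (ball 0 (chainRadius s)) u := by
    intro z hz
    simpa [h0] using! h.norm_sub_one_le hs hz
  have h2 := Complex.eqOn_of_isPreconnected_of_isMaxOn_norm (convex_ball _ _).isPreconnected
    isOpen_ball hd hu hmax (mem_ball_self (chainRadius_pos hs))
  have h3 : ((1 + s : ℝ) : ℂ) ≠ 0 := by exact_mod_cast (by linarith : (1 + s : ℝ) ≠ 0)
  simp only [h0, Function.const_apply, zero_div, sub_left_inj] at h2
  exact h.ne_zero hs ((div_eq_zero_iff.1 h2).resolve_right h3)

/-- Inversion maps the disc `|Q - (1 + s)| ≤ 1 + s`, punctured at `0`, to a half-plane. The constant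
`1 / (2 * (1 + s))` is the logarithmic rate of decay of `chainRadius`. -/
theorem re_le (h : IsCharacteristicPair q₀ q₁) {s : ℝ} (hs : 0 ≤ s) {u : ℂ}
    (hu : u ∈ ball (0 : ℂ) (chainRadius s)) :
    (((1 / (2 * (1 + s)) : ℝ) : ℂ) - (q₀ u + s * q₁ u)⁻¹).re ≤ 0 := by
  have hQ := h.denom_ne_zero hs hu
  have hE := h.norm_sub_one_le hs hu
  set Q := q₀ u + s * q₁ u with hQdef
  have hs1 : 0 < 1 + s := by linarith
  have hn : 0 < Complex.normSq Q := Complex.normSq_pos.2 hQ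
  have h1 : Complex.normSq (Q / ((1 + s : ℝ) : ℂ) - 1) ≤ 1 := by
    rw [Complex.normSq_eq_norm_sq]; exact pow_le_one₀ (norm_nonneg _) hE
  have h2 : Complex.normSq Q ≤ 2 * (1 + s) * Q.re := by
    rw [Complex.normSq_apply, Complex.sub_re, Complex.sub_im, Complex.div_ofReal_re,
      Complex.div_ofReal_im, Complex.one_re, Complex.one_im] at h1
    rw [Complex.normSq_apply]
    have e : (Q.re * Q.re + Q.im * Q.im) - 2 * (1 + s) * Q.re =
      (1 + s) ^ 2 * ((Q.re / (1 + s) - 1) * (Q.re / (1 + s) - 1) +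
        (Q.im / (1 + s) - 0) * (Q.im / (1 + s) - 0) - 1) := by
      field_simp; ring
    have : (1 + s) ^ 2 * ((Q.re / (1 + s) - 1) * (Q.re / (1 + s) - 1) +
        (Q.im / (1 + s) - 0) * (Q.im / (1 + s) - 0) - 1) ≤ 0 :=
      mul_nonpos_of_nonneg_of_nonpos (by positivity) (by linarith)
    linarith
  rw [Complex.sub_re, Complex.ofReal_re, Complex.inv_re, sub_nonpos, div_le_div_iff₀ (by positivity) hn]
  linarith

/-- The characteristic field in the coordinate `w = u / chainRadius s`. -/
noncomputable def scaledField (q₀ q₁ : ℂ → ℂ) (s : ℝ) (w : ℂ) : ℂ :=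
  w * (((1 / (2 * (1 + s)) : ℝ) : ℂ) -
    (q₀ (chainRadius s * w) + s * q₁ (chainRadius s * w))⁻¹)

theorem scaled_mem {s : ℝ} (hs : 0 ≤ s) {w : ℂ} (hw : w ∈ ball (0 : ℂ) 1) :
    (chainRadius s : ℂ) * w ∈ ball (0 : ℂ) (chainRadius s) := by
  have hR := chainRadius_pos hs
  rw [mem_ball_zero_iff] at hw ⊢
  rw [norm_mul, Complex.norm_real, Real.norm_of_nonneg hR.le]
  nlinarith

theorem continuousOn_scaledField (h : IsCharacteristicPair q₀ q₁) {a b : ℝ} (ha : 0 ≤ a) :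
    ContinuousOn (fun p : ℝ × ℂ => scaledField q₀ q₁ p.1 p.2) (Icc a b ×ˢ ball 0 1) := by
  have hr : ContinuousOn (fun p : ℝ × ℂ => (chainRadius p.1 : ℂ) * p.2) (Icc a b ×ˢ ball 0 1) := by
    refine ContinuousOn.mul ?_ continuousOn_snd
    exact Complex.continuous_ofReal.comp_continuousOn
      (continuousOn_chainRadius.comp continuousOn_fst fun p hp => ha.trans hp.1.1)
  have hm : MapsTo (fun p : ℝ × ℂ => (chainRadius p.1 : ℂ) * p.2) (Icc a b ×ˢ ball 0 1)
      (ball 0 1) := fun p hp =>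
    mem_unit_ball (ha.trans hp.1.1) (scaled_mem (ha.trans hp.1.1) hp.2)
  have h0 := h.diff_zero.continuousOn.comp hr hm
  have h1 := h.diff_one.continuousOn.comp hr hm
  refine continuousOn_snd.mul (ContinuousOn.sub ?_ (ContinuousOn.inv₀ (h0.add (ContinuousOn.mul ?_ h1)) ?_))
  · refine Complex.continuous_ofReal.comp_continuousOn
      (continuousOn_const.div (by fun_prop) fun p hp => ?_)
    have := ha.trans hp.1.1
    positivity
  · fun_prop
  · exact fun p hp => h.denom_ne_zero (ha.trans hp.1.1) (scaled_mem (ha.trans hp.1.1) hp.2)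

theorem differentiableOn_scaledField (h : IsCharacteristicPair q₀ q₁) {s : ℝ} (hs : 0 ≤ s) :
    DifferentiableOn ℂ (scaledField q₀ q₁ s) (ball 0 1) := by
  have hr : DifferentiableOn ℂ (fun w : ℂ => (chainRadius s : ℂ) * w) (ball 0 1) := by fun_prop
  have hm : MapsTo (fun w : ℂ => (chainRadius s : ℂ) * w) (ball 0 1) (ball 0 1) :=
    fun w hw => mem_unit_ball hs (scaled_mem hs hw)
  exact differentiableOn_id.mul ((differentiableOn_const _).sub
    (((h.diff_zero.comp hr hm).add ((h.diff_one.comp hr hm).const_mul _)).inv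
      fun w hw => h.denom_ne_zero hs (scaled_mem hs hw)))

theorem inner_scaledField_nonpos (h : IsCharacteristicPair q₀ q₁) {s : ℝ} (hs : 0 ≤ s) {w : ℂ}
    (hw : w ∈ ball (0 : ℂ) 1) : inner ℝ w (scaledField q₀ q₁ s w) ≤ 0 := by
  have hre := h.re_le hs (scaled_mem hs hw)
  rw [scaledField, Complex.inner, mul_right_comm, Complex.mul_conj, Complex.re_ofReal_mul]
  exact mul_nonpos_of_nonneg_of_nonpos (Complex.normSq_nonneg _) hre

/-- `u` solves the characteristic equation on `[a, b]` and stays in the admissible discs. -/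
def IsCharacteristic (q₀ q₁ : ℂ → ℂ) (u : ℝ → ℂ) (a b : ℝ) : Prop :=
  ∀ s ∈ Icc a b, u s ∈ ball (0 : ℂ) (chainRadius s) ∧
    HasDerivWithinAt u (-(u s) / (q₀ (u s) + s * q₁ (u s))) (Icc a b) s

theorem exists_isCharacteristic (h : IsCharacteristicPair q₀ q₁) {a b : ℝ} (ha : 0 ≤ a)
    (hab : a ≤ b) {u₀ : ℂ} (hu₀ : u₀ ∈ ball (0 : ℂ) (chainRadius a)) :
    ∃ u : ℝ → ℂ, u a = u₀ ∧ IsCharacteristic q₀ q₁ u a b := by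
  have hRa := chainRadius_pos ha
  have hw₀ : ‖u₀ / chainRadius a‖ < 1 := by
    rw [norm_div, Complex.norm_real, Real.norm_of_nonneg hRa.le, div_lt_one hRa]
    exact mem_ball_zero_iff.1 hu₀
  -- In the scaled coordinate the field does not point outwards on any circle, so a disc of radius
  -- `ρ < 1` traps the solution and keeps the field uniformly Lipschitz.
  obtain ⟨ρ, hρ, hρ1⟩ := exists_between hw₀
  have hρ0 : 0 < ρ := (norm_nonneg _).trans_lt hρ
  have hsub : closedBall (0 : ℂ) ρ ⊆ ball 0 1 := closedBall_subset_ball hρ1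
  obtain ⟨K, hK⟩ := exists_lipschitzOnWith_of_holomorphic (v := scaledField q₀ q₁) (b := b) hρ1
    (h.continuousOn_scaledField ha) fun t ht => h.differentiableOn_scaledField (ha.trans ht.1)
  obtain ⟨w, hwa, hw⟩ := exists_integralCurve_closedBall hab hρ0 hK
    (fun x hx => (h.continuousOn_scaledField ha).comp (by fun_prop : ContinuousOn (fun t => (t, x)) _)
      fun t ht => ⟨ht, hsub hx⟩)
    (fun t ht x hx => h.inner_scaledField_nonpos (ha.trans ht.1) (hsub hx))
    (mem_closedBall_zero_iff.2 hρ.le)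
  refine ⟨fun s => chainRadius s * w s, ?_, fun s hs => ?_⟩
  · have : (chainRadius a : ℂ) ≠ 0 := by exact_mod_cast hRa.ne'
    simp only [hwa]
    field_simp
  · have hs0 := ha.trans hs.1
    obtain ⟨hwm, hwd⟩ := hw s hs
    refine ⟨scaled_mem hs0 (hsub hwm), ?_⟩
    refine ((hasDerivAt_chainRadius hs0).ofReal_comp.hasDerivWithinAt.mul hwd).congr_deriv ?_
    have : (1 + s : ℂ) ≠ 0 := by exact_mod_cast (by linarith : (1 + s : ℝ) ≠ 0)
    simp only [scaledField]
    push_cast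
    rw [neg_div, div_eq_mul_inv _ (q₀ _ + _)]
    field_simp
    ring

theorem IsCharacteristic.continuousOn {u : ℝ → ℂ} {a b : ℝ} (hu : IsCharacteristic q₀ q₁ u a b) :
    ContinuousOn u (Icc a b) := fun s hs => (hu s hs).2.continuousWithinAt

/-- Characteristics that meet at a later time coincide at the initial time. -/
theorem IsCharacteristic.unique (h : IsCharacteristicPair q₀ q₁) {u v : ℝ → ℂ} {a b : ℝ}
    (ha : 0 ≤ a) (hab : a ≤ b) (hu : IsCharacteristic q₀ q₁ u a b)
    (hv : IsCharacteristic q₀ q₁ v a b) (huv : u b = v b) : u a = v a := by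
  have hscaled : ∀ {u : ℝ → ℂ}, IsCharacteristic q₀ q₁ u a b →
      ContinuousOn (fun s => u s / chainRadius s) (Icc a b) ∧
      (∀ s ∈ Ioc a b, HasDerivWithinAt (fun s => u s / chainRadius s)
        (scaledField q₀ q₁ s (u s / chainRadius s)) (Iic s) s) ∧
      ∃ ρ < 1, ∀ s ∈ Icc a b, u s / chainRadius s ∈ closedBall (0 : ℂ) ρ := by
    intro u hu
    have hd : ∀ s ∈ Icc a b, HasDerivWithinAt (fun s => u s / (chainRadius s : ℂ))
        (scaledField q₀ q₁ s (u s / chainRadius s)) (Icc a b) s := by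
      intro s hs
      have hs0 := ha.trans hs.1
      have hR : (chainRadius s : ℂ) ≠ 0 := by exact_mod_cast (chainRadius_pos hs0).ne'
      have hs1 : (1 + s : ℂ) ≠ 0 := by exact_mod_cast (by linarith : (1 + s : ℝ) ≠ 0)
      refine ((hu s hs).2.div (hasDerivAt_chainRadius hs0).ofReal_comp.hasDerivWithinAt
        hR).congr_deriv ?_
      simp only [scaledField, mul_div_cancel₀ _ hR]
      push_cast
      rw [neg_div, div_eq_mul_inv _ (q₀ _ + _)]
      field_simp
      ring
    have hc : ContinuousOn (fun s => u s / (chainRadius s : ℂ)) (Icc a b) :=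
      fun s hs => (hd s hs).continuousWithinAt
    refine ⟨hc, fun s hs => ?_, ?_⟩
    · exact (hd s (Ioc_subset_Icc_self hs)).mono_of_mem_nhdsWithin (Icc_mem_nhdsLE_of_mem hs)
    -- Compactness of the time interval keeps the scaled curve in a disc of radius below 1, where
    -- the Lipschitz constant is uniform.
    · obtain ⟨x, hx, hmax⟩ := isCompact_Icc.exists_isMaxOn (nonempty_Icc.2 hab) hc.norm
      refine ⟨‖u x / chainRadius x‖, ?_, fun s hs => mem_closedBall_zero_iff.2 (hmax hs)⟩
      have hR := chainRadius_pos (ha.trans hx.1)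
      rw [norm_div, Complex.norm_real, Real.norm_of_nonneg hR.le, div_lt_one hR]
      exact mem_ball_zero_iff.1 (hu x hx).1
  obtain ⟨huc, hud, ρ₁, hρ₁, hu1⟩ := hscaled hu
  obtain ⟨hvc, hvd, ρ₂, hρ₂, hv1⟩ := hscaled hv
  obtain ⟨K, hK⟩ := exists_lipschitzOnWith_of_holomorphic (v := scaledField q₀ q₁) (b := b)
    (max_lt hρ₁ hρ₂)
    (h.continuousOn_scaledField ha) fun t ht => h.differentiableOn_scaledField (ha.trans ht.1)
  have key := ODE_solution_unique_of_mem_Icc_left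
    (s := fun _ => closedBall (0 : ℂ) (max ρ₁ ρ₂))
    (fun t ht => hK t (Ioc_subset_Icc_self ht)) huc hud
    (fun t ht => closedBall_subset_closedBall (le_max_left _ _) (hu1 t (Ioc_subset_Icc_self ht)))
    hvc hvd
    (fun t ht => closedBall_subset_closedBall (le_max_right _ _) (hv1 t (Ioc_subset_Icc_self ht)))
    (by simp only [huv]) ⟨le_rfl, hab⟩
  have hR : (chainRadius a : ℂ) ≠ 0 := by exact_mod_cast (chainRadius_pos ha).ne'
  exact (div_left_inj' hR).1 key

end IsCharacteristicPair

/-! ### The branch of the power, and injectivity near the origin. -/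

/-- If `1 + σ * κ` does not vanish for `0 ≤ σ ≤ s`, then `1 + s * κ` avoids the negative axis. -/
theorem one_add_mul_mem_slitPlane {κ : ℂ} {s : ℝ} (hs : 0 ≤ s)
    (h : ∀ σ : ℝ, 0 ≤ σ → σ ≤ s → 1 + σ * κ ≠ 0) : 1 + s * κ ∈ Complex.slitPlane := by
  by_contra hn
  rw [Complex.mem_slitPlane_iff, not_or, not_lt, not_not] at hn
  obtain ⟨hre, him⟩ := hn
  simp only [Complex.add_re, Complex.one_re, Complex.re_ofReal_mul, Complex.add_im, Complex.one_im,
    Complex.im_ofReal_mul, zero_add] at hre him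
  have hs0 : 0 < s := by
    rcases hs.eq_or_lt with rfl | h'
    · norm_num at hre
    · exact h'
  have hκ : κ.im = 0 := (mul_eq_zero.1 him).resolve_left hs0.ne'
  have hneg : κ.re < 0 := by
    by_contra hc
    nlinarith [mul_nonneg hs0.le (not_lt.1 hc)]
  -- Here `κ` is a negative real and `1 + s * κ ≤ 0`, so `1 + σ * κ` has already vanished at `σ = -1
  -- / κ ≤ s`.
  refine h (-(κ.re)⁻¹) (by simpa using hneg.le) ?_ ?_
  · rw [← inv_neg, inv_le_iff_one_le_mul₀ (by linarith)]
    linarith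
  · exact Complex.ext (by simp [hneg.ne]) (by simp [hκ])

/-- If `1 + σ * κ` does not vanish for `0 ≤ σ`, then `κ` avoids the negative axis. -/
theorem mem_slitPlane_of_one_add_mul_ne_zero {κ : ℂ} (h0 : κ ≠ 0)
    (h : ∀ σ : ℝ, 0 ≤ σ → 1 + σ * κ ≠ 0) : κ ∈ Complex.slitPlane := by
  by_contra hn
  rw [Complex.mem_slitPlane_iff, not_or, not_lt, not_not] at hn
  obtain ⟨hre, him⟩ := hn
  have hne : κ.re ≠ 0 := fun h1 => h0 (Complex.ext h1 him)
  exact h (-(κ.re)⁻¹) (by simpa using hre) (Complex.ext (by simp [hne]) (by simp [him]))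

/-- The functions `u ↦ f u * (ε + κ u) ^ α` are injective on a disc that does not depend on the
small parameter `ε`. -/
theorem exists_uniform_injective {f κ : ℂ → ℂ} (α : ℂ) (hf : AnalyticAt ℂ f 0) (hf0 : f 0 = 0)
    (hf' : deriv f 0 ≠ 0) (hκ : AnalyticAt ℂ κ 0) (hκ0 : κ 0 ∈ Complex.slitPlane) :
    ∃ δ > 0, ∀ ε ∈ ball (0 : ℂ) δ, ∀ u ∈ ball (0 : ℂ) δ, ∀ v ∈ ball (0 : ℂ) δ,
      f u * Complex.exp (α * Complex.log (ε + κ u)) =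
        f v * Complex.exp (α * Complex.log (ε + κ v)) → u = v := by
  let c : ℂ × ℂ → ℂ := fun p => Complex.exp (α * Complex.log (p.2 + κ p.1))
  have hκ1 : AnalyticAt ℂ (fun p : ℂ × ℂ => κ p.1) (0, 0) :=
    AnalyticAt.comp (f := Prod.fst) (x := ((0, 0) : ℂ × ℂ)) hκ analyticAt_fst
  have hc : AnalyticAt ℂ c (0, 0) :=
    (analyticAt_const.mul ((analyticAt_snd.add hκ1).clog (by simpa using hκ0))).cexp
  have hfst : HasStrictFDerivAt (fun p : ℂ × ℂ => f p.1)
      ((ContinuousLinearMap.toSpanSingleton ℂ (deriv f 0)).comp (ContinuousLinearMap.fst ℂ ℂ ℂ))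
      (0, 0) :=
    HasStrictFDerivAt.comp (f := Prod.fst) (x := ((0, 0) : ℂ × ℂ))
      hf.hasStrictDerivAt.hasStrictFDerivAt hasStrictFDerivAt_fst
  -- Strict differentiability in `(u, ε)` jointly makes `δ` independent of `ε`. As `f 0 = 0`, the
  -- derivative at the origin has no `ε` component and multiplies `u` by `c (0, 0) * deriv f 0`.
  have hM := (hfst.mul hc.hasStrictFDerivAt).isLittleO
  have hc0 : c (0, 0) ≠ 0 := Complex.exp_ne_zero _
  have hD : 0 < ‖c (0, 0) * deriv f 0‖ := norm_pos_iff.2 (mul_ne_zero hc0 hf')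
  have hev := hM.def (half_pos hD)
  obtain ⟨δ, hδ, hball⟩ := Metric.eventually_nhds_iff_ball.1 hev
  refine ⟨δ, hδ, fun ε hε u hu v hv huv => ?_⟩
  have hmem : ((u, ε), (v, ε)) ∈ ball (((0, 0), (0, 0)) : (ℂ × ℂ) × (ℂ × ℂ)) δ := by
    rw [← ball_prod_same, ← ball_prod_same]
    exact ⟨⟨hu, hε⟩, hv, hε⟩
  have hb := hball _ hmem
  have huv' : ((fun p : ℂ × ℂ => f p.1) * c) (u, ε) = ((fun p : ℂ × ℂ => f p.1) * c) (v, ε) := huv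
  by_contra hne
  have hpos : 0 < ‖u - v‖ := norm_pos_iff.2 (sub_ne_zero.2 hne)
  have e1 : ‖((u, ε) : ℂ × ℂ) - (v, ε)‖ = ‖u - v‖ := by simp [Prod.norm_def]
  rw [huv', sub_self, zero_sub, norm_neg, e1, hf0] at hb
  simp only [zero_smul ℂ (fderiv ℂ c (0, 0)), zero_add] at hb
  change ‖c (0, 0) * ((u - v) * deriv f 0)‖ ≤ _ at hb
  simp only [norm_mul] at hD hb
  nlinarith [mul_pos hD hpos]

/-! ### The chain and its constancy along characteristics. -/

/-- The data of the chain `f * (1 + s * k / φ) ^ α` with `f u = u * φ u`. -/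
structure IsChainData (α : ℂ) (q₀ q₁ q₂ φ k : ℂ → ℂ) : Prop extends IsCharacteristicPair q₀ q₁ where
  diff_two : DifferentiableOn ℂ q₂ (ball 0 1)
  diff_phi : DifferentiableOn ℂ φ (ball 0 1)
  diff_k : DifferentiableOn ℂ k (ball 0 1)
  k_ne_zero : ∀ u ∈ ball (0 : ℂ) 1, k u ≠ 0
  -- The next two identities make `φ + s * k` solve the linear equation `G' = (q₂ / Q) * G` along
  -- characteristics; `eq_deriv` says `f' = α * q₀ * k`.
  eq_zero : ∀ u ∈ ball (0 : ℂ) 1, q₀ u * k u - u * deriv φ u = q₂ u * φ u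
  eq_one : ∀ u ∈ ball (0 : ℂ) 1, q₁ u * k u - u * deriv k u = q₂ u * k u
  eq_deriv : ∀ u ∈ ball (0 : ℂ) 1, φ u + u * deriv φ u = α * (q₀ u * k u)

namespace IsChainData

open IsCharacteristicPair

variable {α : ℂ} {q₀ q₁ q₂ φ k : ℂ → ℂ}

theorem hasDerivAt_phi (h : IsChainData α q₀ q₁ q₂ φ k) {u : ℂ} (hu : u ∈ ball (0 : ℂ) 1) :
    HasDerivAt φ (deriv φ u) u :=
  (h.diff_phi.differentiableAt (isOpen_ball.mem_nhds hu)).hasDerivAt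

theorem hasDerivAt_k (h : IsChainData α q₀ q₁ q₂ φ k) {u : ℂ} (hu : u ∈ ball (0 : ℂ) 1) :
    HasDerivAt k (deriv k u) u :=
  (h.diff_k.differentiableAt (isOpen_ball.mem_nhds hu)).hasDerivAt

/-- A zero would give `φ u / k u = -s`, but this quotient is bounded near `0`, where the shrinking
discs end up. -/
theorem eventually_ne_zero (h : IsChainData α q₀ q₁ q₂ φ k) :
    ∀ᶠ s : ℝ in atTop, ∀ u ∈ ball (0 : ℂ) (chainRadius s), φ u + s * k u ≠ 0 := by
  have h0 : (0 : ℂ) ∈ ball (0 : ℂ) 1 := mem_ball_self one_pos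
  have hc : ContinuousAt (fun u => ‖φ u / k u‖) 0 :=
    ((h.hasDerivAt_phi h0).continuousAt.div (h.hasDerivAt_k h0).continuousAt
      (h.k_ne_zero 0 h0)).norm
  obtain ⟨δ, hδ, hball⟩ := Metric.eventually_nhds_iff_ball.1
    (hc.tendsto.eventually (gt_mem_nhds (lt_add_one ‖φ 0 / k 0‖)))
  filter_upwards [eventually_ge_atTop (‖φ 0 / k 0‖ + 1), eventually_ge_atTop 0,
    tendsto_chainRadius.eventually (gt_mem_nhds hδ)] with s hs hs0 hsδ u hu hzero
  have hlt := hball u (ball_subset_ball hsδ.le hu)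
  have hk := h.k_ne_zero u (mem_unit_ball hs0 hu)
  have : φ u / k u = -s := by
    field_simp
    linear_combination hzero
  rw [this, norm_neg, Complex.norm_real, Real.norm_of_nonneg hs0] at hlt
  linarith

/-- Along the characteristic from `u₀`, `φ + s * k` solves a homogeneous linear equation, so by
Grönwall an initial zero persists to late times, contradicting `eventually_ne_zero`. No division by
`φ` occurs, so `s = 0` yields `φ ≠ 0`. -/
theorem ne_zero_of_mem_ball (h : IsChainData α q₀ q₁ q₂ φ k) {s : ℝ} (hs : 0 ≤ s) {u₀ : ℂ}
    (hu₀ : u₀ ∈ ball (0 : ℂ) (chainRadius s)) : φ u₀ + s * k u₀ ≠ 0 := by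
  intro hzero
  obtain ⟨T, hT, hsT⟩ := (h.eventually_ne_zero.and (eventually_ge_atTop s)).exists
  obtain ⟨u, hus, hu⟩ := h.exists_isCharacteristic hs hsT hu₀
  have hmem : MapsTo u (Icc s T) (ball 0 1) := fun t ht => mem_unit_ball (hs.trans ht.1) (hu t ht).1
  have huc : ContinuousOn u (Icc s T) := hu.continuousOn
  have hne : ∀ t ∈ Icc s T, q₀ (u t) + t * q₁ (u t) ≠ 0 :=
    fun t ht => h.denom_ne_zero (hs.trans ht.1) (hu t ht).1
  have hd : ∀ t ∈ Icc s T, HasDerivWithinAt (fun t : ℝ => φ (u t) + t * k (u t))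
      (q₂ (u t) / (q₀ (u t) + t * q₁ (u t)) * (φ (u t) + t * k (u t))) (Icc s T) t := by
    intro t ht
    have hut := hmem ht
    have h1 := (h.hasDerivAt_phi hut).comp_hasDerivWithinAt t (hu t ht).2
    have h2 := (h.hasDerivAt_k hut).comp_hasDerivWithinAt t (hu t ht).2
    have h3 := (hasDerivAt_id t).ofReal_comp.hasDerivWithinAt (s := Icc s T)
    refine (h1.add (h3.mul h2)).congr_deriv ?_
    have := hne t ht
    simp only [id, Complex.ofReal_one, Function.comp_apply]
    field_simp
    linear_combination h.eq_zero _ hut + t * h.eq_one _ hut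
  have hcoef : ContinuousOn (fun t : ℝ => q₂ (u t) / (q₀ (u t) + t * q₁ (u t))) (Icc s T) :=
    (h.diff_two.continuousOn.comp huc hmem).div
      ((h.diff_zero.continuousOn.comp huc hmem).add
        (Complex.continuous_ofReal.continuousOn.mul (h.diff_one.continuousOn.comp huc hmem))) hne
  obtain ⟨C, hC⟩ := isCompact_Icc.exists_bound_of_continuousOn hcoef
  have hz := eq_zero_of_abs_deriv_le_mul_abs_self_of_eq_zero_right (K := C)
    (fun t ht => (hd t ht).continuousWithinAt)
    (fun t ht => (hd t (Ico_subset_Icc_self ht)).mono_of_mem_nhdsWithin (Icc_mem_nhdsGE_of_mem ht))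
    (by simpa only [hus] using hzero)
    (fun t ht => by
      rw [norm_mul]
      gcongr
      exact hC t (Ico_subset_Icc_self ht)) T ⟨hsT, le_rfl⟩
  exact hT _ (hu T ⟨hsT, le_rfl⟩).1 hz

theorem phi_ne_zero (h : IsChainData α q₀ q₁ q₂ φ k) {u : ℂ} (hu : u ∈ ball (0 : ℂ) 1) :
    φ u ≠ 0 := by
  simpa using h.ne_zero_of_mem_ball le_rfl (u₀ := u) (by rwa [chainRadius_zero])

theorem one_add_ne_zero (h : IsChainData α q₀ q₁ q₂ φ k) {s : ℝ} (hs : 0 ≤ s) {u : ℂ}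
    (hu : u ∈ ball (0 : ℂ) (chainRadius s)) : 1 + s * (k u / φ u) ≠ 0 := by
  have hφ := h.phi_ne_zero (mem_unit_ball hs hu)
  have := h.ne_zero_of_mem_ball hs hu
  intro h0
  refine this ?_
  have e : φ u + s * k u = φ u * (1 + s * (k u / φ u)) := by field_simp
  rw [e, h0, mul_zero]

/-- The discs decrease in time, so `u` lies in every earlier disc and nonvanishing is available for
all `σ ≤ s`. -/
theorem one_add_mem_slitPlane (h : IsChainData α q₀ q₁ q₂ φ k) {s : ℝ} (hs : 0 ≤ s) {u : ℂ}
    (hu : u ∈ ball (0 : ℂ) (chainRadius s)) : 1 + s * (k u / φ u) ∈ Complex.slitPlane :=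
  one_add_mul_mem_slitPlane hs fun _ hσ hσs =>
    h.one_add_ne_zero hσ (ball_subset_ball (chainRadius_anti hσ hσs) hu)

/-- The chain is constant along characteristics starting at time zero. -/
theorem chain_eq (h : IsChainData α q₀ q₁ q₂ φ k) {u : ℝ → ℂ} {T : ℝ} (hT : 0 ≤ T)
    (hu : IsCharacteristic q₀ q₁ u 0 T) :
    u T * φ (u T) * Complex.exp (α * Complex.log (1 + T * (k (u T) / φ (u T)))) =
      u 0 * φ (u 0) := by
  have hd : ∀ t ∈ Icc 0 T, HasDerivWithinAt
      (fun t : ℝ => u t * φ (u t) * Complex.exp (α * Complex.log (1 + t * (k (u t) / φ (u t)))))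
      0 (Icc 0 T) t := by
    intro t ht
    have hut := mem_unit_ball ht.1 (hu t ht).1
    have hφ := h.phi_ne_zero hut
    have h1 := (h.hasDerivAt_phi hut).comp_hasDerivWithinAt t (hu t ht).2
    have h2 := (h.hasDerivAt_k hut).comp_hasDerivWithinAt t (hu t ht).2
    have h3 := (hasDerivAt_id t).ofReal_comp.hasDerivWithinAt (s := Icc 0 T)
    have h4 := (((HasDerivWithinAt.clog_real (f := fun t : ℝ => 1 + (t : ℂ) * (k (u t) / φ (u t)))
      ((h3.mul (h2.div h1 hφ)).const_add 1)
      (h.one_add_mem_slitPlane ht.1 (hu t ht).1))).const_mul α).cexp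
    refine (((hu t ht).2.mul h1).mul h4).congr_deriv ?_
    have hQ := h.denom_ne_zero ht.1 (hu t ht).1
    have hG := h.ne_zero_of_mem_ball ht.1 (hu t ht).1
    have e0 := h.eq_zero _ hut
    have e1 := h.eq_one _ hut
    have e2 := h.eq_deriv _ hut
    simp only [id, Complex.ofReal_one, Function.comp_apply, Pi.mul_apply, Pi.div_apply]
    generalize Complex.exp _ = e
    have hG' : 1 + t * (k (u t) / φ (u t)) = (φ (u t) + t * k (u t)) / φ (u t) := by
      field_simp
    rw [hG']
    generalize u t = z at *
    generalize deriv φ z = φ' at *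
    generalize deriv k z = k' at *
    generalize q₂ z = c₂ at *
    generalize q₁ z = c₁ at *
    generalize q₀ z = c₀ at *
    generalize φ z = p at *
    generalize k z = κ at *
    field_simp
    linear_combination z * e * (-(p + t * κ) * e2 + α * t * p * e1 - α * t * κ * e0)
  have := constant_of_has_deriv_right_zero (fun t ht => (hd t ht).continuousWithinAt)
    (fun t ht => (hd t (Ico_subset_Icc_self ht)).mono_of_mem_nhdsWithin (Icc_mem_nhdsGE_of_mem ht))
    T (right_mem_Icc.2 hT)
  simpa using this

theorem injOn (h : IsChainData α q₀ q₁ q₂ φ k) : InjOn (fun u => u * φ u) (ball (0 : ℂ) 1) := by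
  have h0 : (0 : ℂ) ∈ ball (0 : ℂ) 1 := mem_ball_self one_pos
  have hnhds : ball (0 : ℂ) 1 ∈ 𝓝 (0 : ℂ) := isOpen_ball.mem_nhds h0
  have hφ0 := h.phi_ne_zero h0
  have hφa : AnalyticAt ℂ φ 0 := h.diff_phi.analyticAt hnhds
  have hd : deriv (fun u => u * φ u) 0 = φ 0 := by
    simpa using! ((hasDerivAt_id (0 : ℂ)).mul (h.hasDerivAt_phi h0)).deriv
  obtain ⟨δ, hδ, hinj⟩ := exists_uniform_injective (f := fun u => u * φ u) (κ := fun u => k u / φ u) α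
    (analyticAt_id.mul hφa) (by simp) (by rwa [hd])
    ((h.diff_k.analyticAt hnhds).div hφa hφ0)
    (mem_slitPlane_of_one_add_mul_ne_zero (div_ne_zero (h.k_ne_zero 0 h0) hφ0)
      fun σ hσ => h.one_add_ne_zero hσ (mem_ball_self (chainRadius_pos hσ)))
  intro z hz w hw hzw
  simp only at hzw
  obtain ⟨T, hTδ, hT0, hTinv⟩ := ((tendsto_chainRadius.eventually (gt_mem_nhds hδ)).and
    ((eventually_gt_atTop 0).and (tendsto_inv_atTop_zero.eventually (gt_mem_nhds hδ)))).exists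
  rw [← chainRadius_zero] at hz hw
  obtain ⟨u, hu0, hu⟩ := h.exists_isCharacteristic le_rfl hT0.le hz
  obtain ⟨v, hv0, hv⟩ := h.exists_isCharacteristic le_rfl hT0.le hw
  have hchain := h.chain_eq hT0.le hu
  rw [hu0, hzw, ← hv0, ← h.chain_eq hT0.le hv] at hchain
  have hTc : (T : ℂ) ≠ 0 := by exact_mod_cast hT0.ne'
  have hT1 : T ∈ Icc 0 T := right_mem_Icc.2 hT0.le
  -- Factoring out `T ^ α` leaves the family of `exists_uniform_injective` with `ε = 1 / T`.
  have hlog : ∀ x ∈ ball (0 : ℂ) (chainRadius T),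
      Complex.exp (α * Complex.log (1 + T * (k x / φ x))) =
        Complex.exp (α * Real.log T) *
          Complex.exp (α * Complex.log ((T⁻¹ : ℝ) + k x / φ x)) := by
    intro x hx
    have e : 1 + T * (k x / φ x) = T * (((T⁻¹ : ℝ) : ℂ) + k x / φ x) := by
      push_cast; rw [mul_add, mul_inv_cancel₀ hTc]
    have hne : ((T⁻¹ : ℝ) : ℂ) + k x / φ x ≠ 0 := by
      intro h1
      exact h.one_add_ne_zero hT0.le hx (by rw [e, h1, mul_zero])
    rw [e, Complex.log_ofReal_mul hT0 hne, mul_add, Complex.exp_add]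
  rw [hlog _ (hu T hT1).1, hlog _ (hv T hT1).1, mul_left_comm, mul_left_comm _ (Complex.exp _)] at hchain
  have hfin := hinj ((T⁻¹ : ℝ) : ℂ)
    (by rw [mem_ball_zero_iff, Complex.norm_real, Real.norm_of_nonneg (by positivity)]; exact hTinv)
    _ (ball_subset_ball hTδ.le (hu T hT1).1) _ (ball_subset_ball hTδ.le (hv T hT1).1)
    (mul_left_cancel₀ (Complex.exp_ne_zero _) hchain)
  rw [← hu0, ← hv0]
  exact IsCharacteristic.unique h.toIsCharacteristicPair le_rfl hT0.le hu hv hfin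

end IsChainData

/-! ### Zeros of `f` off the origin. -/

/-- A holomorphic function whose logarithmic derivative is bounded near an isolated point of
`{z | f z ≠ 0}` does not vanish there. -/
theorem ne_zero_of_norm_deriv_le {f : ℂ → ℂ} {z₀ : ℂ} {C : ℝ} (hf : AnalyticAt ℂ f z₀)
    (hne : ∀ᶠ z in 𝓝[≠] z₀, f z ≠ 0) (hC : ∀ᶠ z in 𝓝[≠] z₀, ‖deriv f z‖ ≤ C * ‖f z‖) :
    f z₀ ≠ 0 := by
  intro h0
  have hz₀ : ‖deriv f z₀‖ ≤ C * ‖f z₀‖ :=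
    le_of_tendsto_of_tendsto (hf.deriv.continuousAt.norm.tendsto.mono_left nhdsWithin_le_nhds)
      ((hf.continuousAt.norm.const_mul C).tendsto.mono_left nhdsWithin_le_nhds) hC
  have hall : ∀ᶠ z in 𝓝 z₀, ‖deriv f z‖ ≤ C * ‖f z‖ := by
    rw [← nhdsNE_sup_pure, eventually_sup]
    exact ⟨hC, hz₀⟩
  obtain ⟨r, hr, hball⟩ := Metric.eventually_nhds_iff_ball.1
    ((hall.and hf.eventually_analyticAt).and (eventually_nhdsWithin_iff.1 hne))
  have hmem : ∀ t ∈ Icc 0 (r / 2), z₀ + (t : ℂ) ∈ ball z₀ r := by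
    intro t ht
    rw [mem_ball_iff_norm, add_sub_cancel_left, Complex.norm_real, Real.norm_of_nonneg ht.1]
    linarith [ht.2]
  -- Grönwall along a short horizontal segment propagates the zero at `z₀`, which contradicts its
  -- isolation.
  have hd : ∀ t ∈ Icc 0 (r / 2), HasDerivAt (fun t : ℝ => f (z₀ + t)) (deriv f (z₀ + t)) t := by
    intro t ht
    have h1 : HasDerivAt (fun t : ℝ => z₀ + (t : ℂ)) 1 t :=
      ((hasDerivAt_id t).ofReal_comp.const_add z₀)
    simpa using! (hball _ (hmem t ht)).1.2.differentiableAt.hasDerivAt.comp t h1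
  have hz := eq_zero_of_abs_deriv_le_mul_abs_self_of_eq_zero_right (K := C)
    (fun t ht => (hd t ht).continuousAt.continuousWithinAt)
    (fun t ht => (hd t (Ico_subset_Icc_self ht)).hasDerivWithinAt)
    (by simpa using h0) (fun t ht => (hball _ (hmem t (Ico_subset_Icc_self ht))).1.1)
    (r / 2) ⟨by positivity, le_rfl⟩
  refine (hball _ (hmem (r / 2) ⟨by positivity, le_rfl⟩)).2 ?_ hz
  have : ((r / 2 : ℝ) : ℂ) ≠ 0 := by exact_mod_cast (half_pos hr).ne'
  simpa using this

namespace IsNormalizedAnalytic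

variable {f : ℂ → ℂ}

theorem eventually_ne_zero (hf : IsNormalizedAnalytic f) {u : ℂ} (hu : u ∈ unitDisk) :
    ∀ᶠ z in 𝓝[≠] u, f z ≠ 0 := by
  by_contra hn
  have h0 : (0 : ℂ) ∈ unitDisk := mem_ball_self one_pos
  have heq := hf.analytic.eqOn_zero_of_preconnected_of_frequently_eq_zero
    (convex_ball _ _).isPreconnected hu (by simpa only [Filter.Frequently] using hn)
  have hev : f =ᶠ[𝓝 0] 0 := heq.eventuallyEq_of_mem (isOpen_ball.mem_nhds h0)
  have := hf.deriv_zero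
  rw [hev.deriv_eq] at this
  simp at this

theorem mul_dslope (hf : IsNormalizedAnalytic f) (u : ℂ) : u * dslope f 0 u = f u := by
  simpa [hf.map_zero] using sub_smul_dslope f 0 u

theorem dslope_zero (hf : IsNormalizedAnalytic f) : dslope f 0 0 = 1 := by
  rw [dslope_same, hf.deriv_zero]

theorem differentiableOn_dslope (hf : IsNormalizedAnalytic f) :
    DifferentiableOn ℂ (dslope f 0) (ball 0 1) :=
  (Complex.differentiableOn_dslope (isOpen_ball.mem_nhds (mem_ball_self one_pos))).2
    hf.analytic.differentiableOn

theorem dslope_add_mul_deriv (hf : IsNormalizedAnalytic f) {u : ℂ} (hu : u ∈ unitDisk) :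
    dslope f 0 u + u * deriv (dslope f 0) u = deriv f u := by
  have h1 := (hf.differentiableOn_dslope.differentiableAt (isOpen_ball.mem_nhds hu)).hasDerivAt
  have h2 := (hasDerivAt_id u).mul h1
  have h3 : (id * dslope f 0) = f := funext hf.mul_dslope
  rw [h3] at h2
  simpa using h2.deriv.symm

/-- A bound of the type used in univalence criteria excludes zeros of `f` off the origin, as it
bounds the logarithmic derivative near such a zero. -/
theorem ne_zero_of_norm_add_le (hf : IsNormalizedAnalytic f) {a : ℂ → ℂ} {b : ℂ} {C : ℝ}
    (hb : b ≠ 0) (ha : ContinuousOn a unitDisk)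
    (h : ∀ z ∈ unitDisk, f z ≠ 0 →
      ‖a z + ((1 - ‖z‖ ^ 2 : ℝ) : ℂ) * (b * (z * deriv f z / f z))‖ ≤ C)
    {z₀ : ℂ} (hz₀ : z₀ ∈ unitDisk) (hz₀0 : z₀ ≠ 0) : f z₀ ≠ 0 := by
  have hnhds : unitDisk ∈ 𝓝 z₀ := isOpen_ball.mem_nhds hz₀
  have hne := hf.eventually_ne_zero hz₀
  -- This coefficient of `f' / f` is nonzero at `z₀`, so the assumed bound controls `f' / f` near
  -- `z₀`.
  let c : ℂ → ℂ := fun z => ((1 - ‖z‖ ^ 2 : ℝ) : ℂ) * (b * z)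
  have hc : ContinuousAt c z₀ := by fun_prop
  have hc0 : c z₀ ≠ 0 := by
    have h1 : ‖z₀‖ < 1 := mem_ball_zero_iff.1 hz₀
    have h2 : (1 - ‖z₀‖ ^ 2 : ℝ) ≠ 0 := by nlinarith [norm_nonneg z₀]
    exact mul_ne_zero (by exact_mod_cast h2) (mul_ne_zero hb hz₀0)
  have hbd : ContinuousAt (fun z => (C + ‖a z‖) / ‖c z‖) z₀ :=
    (continuousAt_const.add (ha.continuousAt hnhds).norm).div hc.norm (norm_ne_zero_iff.2 hc0)
  refine ne_zero_of_norm_deriv_le (C := (C + ‖a z₀‖) / ‖c z₀‖ + 1) (hf.analytic z₀ hz₀) hne ?_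
  filter_upwards [hne, nhdsWithin_le_nhds hnhds,
    nhdsWithin_le_nhds (hbd.tendsto.eventually (gt_mem_nhds (lt_add_one _))),
    nhdsWithin_le_nhds (hc.eventually_ne hc0)] with z hfz hz hlt hcz
  have hcpos : 0 < ‖c z‖ := norm_pos_iff.2 hcz
  have hfpos : 0 < ‖f z‖ := norm_pos_iff.2 hfz
  have e : ((1 - ‖z‖ ^ 2 : ℝ) : ℂ) * (b * (z * deriv f z / f z)) = c z * (deriv f z / f z) := by
    simp only [c]; ring
  have h1 := h z hz hfz
  rw [e] at h1
  have h2 : ‖c z‖ * ‖deriv f z / f z‖ ≤ C + ‖a z‖ := by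
    rw [← norm_mul]
    have := norm_sub_le (a z + c z * (deriv f z / f z)) (a z)
    rw [add_sub_cancel_left] at this
    linarith
  have h3 : ‖deriv f z / f z‖ ≤ (C + ‖a z‖) / ‖c z‖ := by
    rw [le_div_iff₀ hcpos, mul_comm]; exact h2
  rw [norm_div, div_le_iff₀ hfpos] at h3
  exact h3.trans (by gcongr)

end IsNormalizedAnalytic

/-! ### Verification of the chain data. -/

theorem corollary3p2 (f g : ℂ → ℂ) (α β A : ℂ)
    (hf : IsNormalizedAnalytic f)
    (hg : AnalyticOnNhd ℂ g unitDisk) (hg0 : g 0 = 1)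
    (hgβ : ∀ z ∈ unitDisk, g z ≠ β)
    (hα : 1 / 2 < α.re) (hA0 : A ≠ 0) (hA1 : ‖A‖ ≤ 1)
    (h1 : ∀ z ∈ unitDisk, ‖(1 / α) * (deriv f z / (g z - β) - 1)‖ < ‖A‖)
    (h2 : ∀ z ∈ unitDisk, f z ≠ 0 →
      ‖(deriv f z / (g z - β) - 1) * ((‖z‖ ^ 2 : ℝ) : ℂ)
        + ((1 - ‖z‖ ^ 2 : ℝ) : ℂ) *
          (((1 - α) / α) * (z * deriv f z / f z) + z * deriv g z / (g z - β))‖ ≤ ‖A‖) :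
    IsUnivalentOn f unitDisk := by
  have hα0 : α ≠ 0 := by
    rintro rfl
    norm_num at hα
  have h0 : (0 : ℂ) ∈ unitDisk := mem_ball_self one_pos
  have hh : ∀ z ∈ unitDisk, g z - β ≠ 0 := fun z hz => sub_ne_zero.2 (hgβ z hz)
  have hdf : DifferentiableOn ℂ (deriv f) unitDisk := hf.analytic.deriv.differentiableOn
  have hdg : DifferentiableOn ℂ (deriv g) unitDisk := hg.deriv.differentiableOn
  have hgd : DifferentiableOn ℂ (fun z => g z - β) unitDisk := hg.differentiableOn.sub_const β
  have hq₀ : DifferentiableOn ℂ (fun z => deriv f z / (g z - β)) unitDisk := hdf.div hgd hh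
  have hlg : DifferentiableOn ℂ (fun z => z * deriv g z / (g z - β)) unitDisk :=
    (differentiableOn_id.mul hdg).div hgd hh
  have hφ := hf.differentiableOn_dslope
  -- For `α = 1` the term in `f' / f` disappears and the bound does not exclude zeros of `f`, but
  -- then `N = 0`. In both cases `N` is holomorphic and `hNφ` holds.
  have hcase : (1 - α) / α = 0 ∨ ∀ z ∈ unitDisk, dslope f 0 z ≠ 0 := by
    refine or_iff_not_imp_left.2 fun hb z hz hz0 => ?_
    rcases eq_or_ne z 0 with rfl | hne
    · rw [hf.dslope_zero] at hz0
      exact one_ne_zero hz0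
    · refine hf.ne_zero_of_norm_add_le (C := ‖A‖) (a := fun z =>
        (deriv f z / (g z - β) - 1) * ((‖z‖ ^ 2 : ℝ) : ℂ) + ((1 - ‖z‖ ^ 2 : ℝ) : ℂ) * (z * deriv g z / (g z - β))) hb ?_
        (fun w hw hfw => ?_) hz hne (by rw [← hf.mul_dslope, hz0, mul_zero])
      · exact ((hq₀.continuousOn.sub continuousOn_const).mul (by fun_prop)).add
          (ContinuousOn.mul (by fun_prop) hlg.continuousOn)
      · exact (congrArg norm (by ring)).trans_le (h2 w hw hfw)
  let N : ℂ → ℂ := fun z => (1 - α) / α * deriv f z / dslope f 0 z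
  have hN : DifferentiableOn ℂ N unitDisk := by
    rcases hcase with hb | hb
    · simp only [N, hb, zero_mul, zero_div]
      exact differentiableOn_const 0
    · exact (hdf.const_mul _).div hφ hb
  have hNφ : ∀ z ∈ unitDisk, N z * dslope f 0 z = (1 - α) / α * deriv f z := by
    intro z hz
    rcases hcase with hb | hb
    · simp [N, hb]
    · exact div_mul_cancel₀ _ (hb z hz)
  have hq₁ : DifferentiableOn ℂ (fun z => N z + 1 + z * deriv g z / (g z - β)) unitDisk :=
    (hN.add_const 1).add hlg
  have hdata : IsChainData α (fun z => deriv f z / (g z - β))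
      (fun z => N z + 1 + z * deriv g z / (g z - β)) (fun z => N z + 1) (dslope f 0)
      (fun z => (g z - β) / α) := by
    have hk : ∀ u ∈ unitDisk, deriv (fun z => (g z - β) / α) u = deriv g u / α := fun u hu =>
      (((hg u hu).differentiableAt.hasDerivAt.sub_const β).div_const α).deriv
    refine
      { diff_zero := hq₀
        diff_one := hq₁
        norm_le := fun u hu => ?_
        zero_ne_zero := ?_
        one_re_pos := ?_
        diff_two := hN.add_const 1
        diff_phi := hφ
        diff_k := hgd.div_const α
        k_ne_zero := fun u hu => div_ne_zero (hh u hu) hα0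
        eq_zero := fun u hu => ?_
        eq_one := fun u hu => ?_
        eq_deriv := fun u hu => ?_ }
    · have hu' : unitDisk ∈ 𝓝 u := isOpen_ball.mem_nhds hu
      have hc : ContinuousAt (fun u : ℂ => ‖deriv f u / (g u - β) * ((‖u‖ ^ 2 : ℝ) : ℂ) +
          ((1 - ‖u‖ ^ 2 : ℝ) : ℂ) * (N u + 1 + u * deriv g u / (g u - β)) - 1‖) u :=
        ((((hq₀.continuousOn.continuousAt hu').mul (by fun_prop)).add
          (ContinuousAt.mul (by fun_prop) (hq₁.continuousOn.continuousAt hu'))).sub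
            continuousAt_const).norm
      -- The bound is given only where `f ≠ 0`; zeros of `f` are isolated, so continuity extends it
      -- to every point, including the origin.
      refine le_of_tendsto (hc.tendsto.mono_left (nhdsWithin_le_nhds (s := {u}ᶜ))) ?_
      filter_upwards [hf.eventually_ne_zero hu, nhdsWithin_le_nhds hu'] with z hfz hz
      refine (congrArg norm ?_).trans_le ((h2 z hz hfz).trans hA1)
      have hz0 : z ≠ 0 := by
        rintro rfl
        exact hfz hf.map_zero
      have hφz : dslope f 0 z ≠ 0 := by
        intro hz1
        exact hfz (by rw [← hf.mul_dslope, hz1, mul_zero])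
      have e : N z = (1 - α) / α * (z * deriv f z / f z) := by
        rw [← hf.mul_dslope z, mul_div_mul_left _ _ hz0, ← mul_div_assoc]
      rw [e]
      push_cast
      ring
    · simp only [hf.deriv_zero]
      exact div_ne_zero one_ne_zero (hh 0 h0)
    -- The normalization of `f` gives `N 0 = (1 - α) / α`, so `q₁ 0 = 1 / α`, whose real part has
    -- the sign of `Re α`.
    · have e : N 0 + 1 + 0 * deriv g 0 / (g 0 - β) = α⁻¹ := by
        simp only [N, hf.deriv_zero, hf.dslope_zero]
        field_simp
        ring
      simp only [e, Complex.inv_re]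
      exact div_pos (by linarith) (Complex.normSq_pos.2 hα0)
    · have e1 := hf.dslope_add_mul_deriv hu
      have e2 := hNφ u hu
      have e3 : deriv f u / (g u - β) * ((g u - β) / α) = deriv f u / α := by
        have := hh u hu
        field_simp
      have e4 : (1 - α) / α * deriv f u = deriv f u / α - deriv f u := by
        field_simp
      simp only [e3]
      linear_combination -e2 - e4 - e1
    · have := hh u hu
      simp only [hk u hu]
      field_simp
      ring
    · have := hh u hu
      rw [hf.dslope_add_mul_deriv hu]
      field_simp
  refine ⟨hf.analytic, ?_⟩
  have := hdata.injOn
  rwa [show (fun u => u * dslope f 0 u) = f from funext hf.mul_dslope] at this
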